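/- Let $(\Omega,\mathcal F,(\mathcal F_t)_{t=0}^T,P)$ be a filtered probability space with $\Omega$ finite, $P(\omega)>0$ for all $\omega\in\Omega$, $\mathcal F_0=\{\emptyset,\Omega\}$ and $\mathcal F_T=\mathcal F$. Let $(\Pi_t)_{t=0}^T$, $\Pi_t=(\pi_t^{jk})_{1\le j,k\le d}$, be an adapted process of bid-ask matrices, i.e. $\pi_t^{jk}>0$, $\pi_t^{jj}=1$ and $\pi_t^{jk}\le\pi_t^{jl}\pi_t^{lk}$ for all $j,k,l$, and let $K_t(\omega)\subseteq\mathbb R^d$ be the convex cone spanned by the vectors $\pi_t^{jk}(\omega)e^j-e^k$ and $e^j$, $1\le j,k\le d$. Let $A_T$ be the set of terminal values $V_T$ of adapted $\mathbb R^d$-valued processes $(V_t)_{t=0}^T$ with $V_t-V_{t-1}\in -K_t$ $P$-a.s. for $t=0,\dots,T$, where $V_{-1}=0$. Assume no arbitrage (NA): every element of $A_T$ that takes values in $\mathbb R^d_+$ $P$-a.s. is $0$ $P$-a.s. For a claim, i.e. an $\mathcal F_T$-measurable random vector $X:\Omega\to\mathbb R^d$, and an asset $i\in\{1,\dots,d\}$,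 the scalar superhedging price of $X$ in units of asset $i$ is $$\pi^a_i(X)=\inf\{s\in\mathbb R:\ X-s\,e^i\in A_T\}.$$ Let $\Omega_t$ be the set of atoms of $\mathcal F_t$ (the nodes at time $t$), and for $\omega\in\Omega_t$, $t<T$, let $\mathrm{succ}(\omega)=\{\bar\omega\in\Omega_{t+1}:\bar\omega\subseteq\omega\}$. For $f:\mathbb R^d\to\mathbb R\cup\{-\infty\}$ let $\mathrm{hypo}\,f=\{(x,r)\in\mathbb R^d\times\mathbb R: r\le f(x)\}$. For concave functions $f_1,\dots,f_m:\mathbb R^d\to\mathbb R\cup\{-\infty\}$, the concave cap $\mathrm{cap}\{f_1,\dots,f_m\}$ is the function whose hypograph is the closed convex hull of $\bigcup_{l=1}^m\mathrm{hypo}\,f_l$. Then the following backward recursion is well defined and yields concave functions $V_t^\omega,\widetilde V_t^\omega:\mathbb R^d\to\mathbb R\cup\{-\infty\}$ for all $t\in\{0,\dots,T\}$ and $\omega\in\Omega_t$. 1. For $\omega\in\Omega_T$: $V_T^\omega(S)=\widetilde V_T^\omega(S)=X(\omega)^{\mathsf T}S$ if $S^i=1$ and $S^k\le\pi_T^{jk}(\omega)S^j$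 for all $1\le j,k\le d$, and $V_T^\omega(S)=\widetilde V_T^\omega(S)=-\infty$ otherwise. 2. For $t=T-1,\dots,0$ and $\omega\in\Omega_t$: $V_t^\omega=\mathrm{cap}\{\widetilde V_{t+1}^{\bar\omega}:\bar\omega\in\mathrm{succ}(\omega)\}$; and $\widetilde V_t^\omega(S)=V_t^\omega(S)$ if $S^i=1$ and $S^k\le\pi_t^{jk}(\omega)S^j$ for all $1\le j,k\le d$, and $\widetilde V_t^\omega(S)=-\infty$ otherwise. Moreover, $\pi^a_i(X)$ is a real number and, writing $\widetilde V_0$ for the function $\widetilde V_0^\omega$ at the unique node $\omega=\Omega$ of time $0$, $$\pi^a_i(X)=\max_{S\in\mathbb R^d}\widetilde V_0(S),$$ the maximum being attained. -/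

import Mathlib

open MeasureTheory Set

/-- A bid-ask matrix: `p j k` units of asset `j` buy one unit of asset `k`. -/
structure IsBidAskMatrix {d : ℕ} (p : Matrix (Fin d) (Fin d) ℝ) : Prop where
  pos : ∀ j k, 0 < p j k
  diag : ∀ j, p j j = 1
  triangle : ∀ j k l, p j k ≤ p j l * p l k

/-- The solvency cone: the convex cone spanned by the vectors `p j k • e j - e k` and the unit
vectors `e j`. -/
noncomputable def solvencyCone {d : ℕ} (p : Matrix (Fin d) (Fin d) ℝ) :
    PointedCone ℝ (Fin d → ℝ) :=
  PointedCone.hull ℝ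
    ({v | ∃ j k, v = p j k • (Pi.single j 1 : Fin d → ℝ) - Pi.single k 1} ∪
      {v | ∃ j, v = Pi.single j 1})

/-- The price vectors `S` with `S i = 1` and `S k ≤ p j k * S j` for all `j`, `k`. -/
def IsConsistentPrice {d : ℕ} (p : Matrix (Fin d) (Fin d) ℝ) (i : Fin d) (S : Fin d → ℝ) : Prop :=
  S i = 1 ∧ ∀ j k, S k ≤ p j k * S j

/-- The atoms of a σ-algebra: its nonempty members that are minimal. -/
def sigmaAtoms {Ω : Type*} (m : MeasurableSpace Ω) : Set (Set Ω) :=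
  {A | MeasurableSet[m] A ∧ A.Nonempty ∧ ∀ B, MeasurableSet[m] B → B ⊆ A → B = ∅ ∨ B = A}

/-- The hypograph of an extended real valued function. -/
def hypograph {E : Type*} (f : E → EReal) : Set (E × ℝ) :=
  {q | (q.2 : EReal) ≤ f q.1}

/-- `g` is the concave cap of the family `f B`, `B ∈ s`: the hypograph of `g` is the closed convex
hull of the union of the hypographs of the `f B`. -/
def IsConcaveCap {d : ℕ} {ι : Type*} (g : (Fin d → ℝ) → EReal) (s : Set ι)
    (f : ι → (Fin d → ℝ) → EReal) : Prop :=
  hypograph g = closure (convexHull ℝ (⋃ B ∈ s, hypograph (f B)))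

/-- A market with `d` assets, times `0, …, T` and proportional transaction costs: a filtration
with `ℱ 0` trivial and `ℱ T` the whole σ-algebra (indices beyond `T` play no role), and an adapted
process of bid-ask matrices. -/
structure Market (Ω : Type*) [mΩ : MeasurableSpace Ω] (d T : ℕ) where
  /-- the filtration -/
  ℱ : Filtration ℕ mΩ
  zero_trivial : ℱ 0 = ⊥
  last_eq : ℱ T = mΩ
  /-- the bid-ask matrices -/
  bidAsk : ℕ → Ω → Matrix (Fin d) (Fin d) ℝ
  adapted : ∀ t ≤ T, ∀ j k, Measurable[ℱ t] fun ω => bidAsk t ω j k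
  isBidAsk : ∀ t ≤ T, ∀ ω, IsBidAskMatrix (bidAsk t ω)

namespace Market

variable {Ω : Type*} [MeasurableSpace Ω] {d T : ℕ}

/-- The solvency cone at time `t` in the state `ω`. -/
noncomputable def cone (M : Market Ω d T) (t : ℕ) (ω : Ω) : PointedCone ℝ (Fin d → ℝ) :=
  solvencyCone (M.bidAsk t ω)

/-- The nodes at time `t`: the atoms of `ℱ t`. -/
def nodes (M : Market Ω d T) (t : ℕ) : Set (Set Ω) :=
  sigmaAtoms (M.ℱ t)

/-- The successor nodes (at time `t + 1`) of the node `A` at time `t`. -/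
def succNodes (M : Market Ω d T) (t : ℕ) (A : Set Ω) : Set (Set Ω) :=
  {B | B ∈ M.nodes (t + 1) ∧ B ⊆ A}

/-- `V` is a self-financing portfolio process: it is adapted and `V t - V (t - 1) ∈ - K t` a.s. for
`t = 0, …, T`, with the convention that the portfolio before time `0` is `0`. -/
def IsSelfFinancing (M : Market Ω d T) (P : Measure Ω) (V : ℕ → Ω → Fin d → ℝ) : Prop :=
  (∀ t ≤ T, Measurable[M.ℱ t] (V t)) ∧
  (∀ᵐ ω ∂P, -(V 0 ω) ∈ M.cone 0 ω) ∧
  ∀ t < T, ∀ᵐ ω ∂P, -(V (t + 1) ω - V t ω) ∈ M.cone (t + 1) ω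

/-- The claims that are superhedgeable from initial endowment `0`: terminal values of
self-financing portfolio processes. -/
def attainable (M : Market Ω d T) (P : Measure Ω) : Set (Ω → Fin d → ℝ) :=
  {Y | Measurable Y ∧ ∃ V, M.IsSelfFinancing P V ∧ Y =ᵐ[P] V T}

/-- No arbitrage: an attainable claim with a.s. nonnegative components is a.s. zero. -/
def NoArbitrage (M : Market Ω d T) (P : Measure Ω) : Prop :=
  ∀ Y ∈ M.attainable P, (∀ᵐ ω ∂P, 0 ≤ Y ω) → Y =ᵐ[P] 0

/-- The initial portfolios that allow to superhedge the claim `X`. -/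
def superhedgingPortfolios (M : Market Ω d T) (P : Measure Ω) (X : Ω → Fin d → ℝ) :
    Set (Fin d → ℝ) :=
  {x | (fun ω => X ω - x) ∈ M.attainable P}

/-- The scalar superhedging price in units of asset `i`: the infimum of the `i`-th coordinate over
the superhedging portfolios that are multiples of the unit vector `e i`. -/
noncomputable def scalarPrice (M : Market Ω d T) (P : Measure Ω) (X : Ω → Fin d → ℝ)
    (i : Fin d) : EReal :=
  ⨅ u ∈ M.superhedgingPortfolios P X ∩ {u | ∃ s : ℝ, u = s • (Pi.single i 1 : Fin d → ℝ)},
    ((u i : ℝ) : EReal)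

/-- `V t A` and `W t A` (the truncated functions) are value functions at the nodes `A` that result
from the backward algorithm for the claim `X` and the numéraire asset `i`. Bid-ask matrices and
`X` are constant on the nodes where they are evaluated. -/
structure IsScalarAlgorithm (M : Market Ω d T) (X : Ω → Fin d → ℝ) (i : Fin d)
    (V W : ℕ → Set Ω → (Fin d → ℝ) → EReal) : Prop where
  terminal_pos : ∀ A ∈ M.nodes T, ∀ ω ∈ A, ∀ S, IsConsistentPrice (M.bidAsk T ω) i S →
    V T A S = ((X ω ⬝ᵥ S : ℝ) : EReal)
  terminal_neg : ∀ A ∈ M.nodes T, ∀ ω ∈ A, ∀ S, ¬ IsConsistentPrice (M.bidAsk T ω) i S →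
    V T A S = ⊥
  terminal_eq : ∀ A ∈ M.nodes T, W T A = V T A
  cap : ∀ t < T, ∀ A ∈ M.nodes t, IsConcaveCap (V t A) (M.succNodes t A) (W (t + 1))
  cut_pos : ∀ t < T, ∀ A ∈ M.nodes t, ∀ ω ∈ A, ∀ S, IsConsistentPrice (M.bidAsk t ω) i S →
    W t A S = V t A S
  cut_neg : ∀ t < T, ∀ A ∈ M.nodes t, ∀ ω ∈ A, ∀ S, ¬ IsConsistentPrice (M.bidAsk t ω) i S →
    W t A S = ⊥

end Market

/-! ### Duality between the solvency cone and consistent prices. -/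

section BidAsk

variable {d : ℕ} {p : Matrix (Fin d) (Fin d) ℝ}

/-! The recursion is the dual form of superhedging: a portfolio `y` acts as the linear function `S ↦
y ⬝ᵥ S`, and it can carry on from a node exactly when this function dominates the value function
there, up to boundary cases.

Lower bound (`le_dotProduct`): the region below a linear function is closed and convex, so
domination survives the cap, and trading never raises the value of a position at consistent prices.
Hence every superhedging strategy dominates the value functions, by backward induction.

Upper bound (`exists_strategy`): if `x` lies strictly above the truncated value function at a node,
Hahn-Banach separates its graph over the compact set of consistent prices from the closed hypograph
of the untruncated one. The separating hyperplane is the graph of a portfolio `y` reachable from `x`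
(`exists_trade_forall_lt`), which then dominates at all successors. Strict inequalities suffice
because the price is an infimum.

No arbitrage enters only to exclude an initial function identically `⊥` (`exists_truncated_ne_bot`);
compactness then yields a maximiser. -/

lemma IsConsistentPrice.nonneg (hp : IsBidAskMatrix p) {i : Fin d} {S : Fin d → ℝ}
    (hS : IsConsistentPrice p i S) (j : Fin d) : 0 ≤ S j := by
  have h1 := hS.2 j i
  rw [hS.1] at h1
  by_contra hneg
  nlinarith [hp.pos j i]

/-- The normalisation `S i = 1` traps prices in the box with sides `[0, p i k]`. -/
lemma isCompact_setOf_isConsistentPrice (hp : IsBidAskMatrix p) (i : Fin d) :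
    IsCompact {S | IsConsistentPrice p i S} := by
  have hcl : IsClosed {S | IsConsistentPrice p i S} := by
    have : {S | IsConsistentPrice p i S} =
        {S : Fin d → ℝ | S i = 1} ∩ ⋂ j, ⋂ k, {S : Fin d → ℝ | S k ≤ p j k * S j} := by
      ext S
      simp [IsConsistentPrice]
    rw [this]
    refine (isClosed_eq (by fun_prop) (by fun_prop)).inter ?_
    exact isClosed_iInter fun j => isClosed_iInter fun k => isClosed_le (by fun_prop) (by fun_prop)
  refine (isCompact_Icc (a := (0 : Fin d → ℝ)) (b := fun k => p i k)).of_isClosed_subset hcl ?_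
  intro S hS
  refine ⟨fun j => hS.nonneg hp j, fun k => ?_⟩
  have := hS.2 i k
  rwa [hS.1, mul_one] at this

lemma convex_setOf_isConsistentPrice (p : Matrix (Fin d) (Fin d) ℝ) (i : Fin d) :
    Convex ℝ {S | IsConsistentPrice p i S} := by
  intro S hS S' hS' a b ha hb hab
  refine ⟨by simp [hS.1, hS'.1, hab], fun j k => ?_⟩
  simp only [Pi.add_apply, Pi.smul_apply, smul_eq_mul]
  nlinarith [mul_le_mul_of_nonneg_left (hS.2 j k) ha, mul_le_mul_of_nonneg_left (hS'.2 j k) hb]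

lemma smul_mem_solvencyCone {v : Fin d → ℝ} (hv : v ∈ solvencyCone p) {c : ℝ} (hc : 0 ≤ c) :
    c • v ∈ solvencyCone p :=
  (solvencyCone p).smul_mem hc hv

lemma single_mem_solvencyCone (j : Fin d) : (Pi.single j 1 : Fin d → ℝ) ∈ solvencyCone p :=
  PointedCone.subset_hull (Or.inr ⟨j, rfl⟩)

lemma exchange_mem_solvencyCone (j k : Fin d) :
    p j k • (Pi.single j 1 : Fin d → ℝ) - Pi.single k 1 ∈ solvencyCone p :=
  PointedCone.subset_hull (Or.inl ⟨j, k, rfl⟩)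

lemma IsConsistentPrice.dotProduct_nonneg (hp : IsBidAskMatrix p) {i : Fin d} {S v : Fin d → ℝ}
    (hS : IsConsistentPrice p i S) (hv : v ∈ solvencyCone p) : 0 ≤ v ⬝ᵥ S := by
  refine Submodule.span_induction (p := fun v _ => 0 ≤ v ⬝ᵥ S) ?_ (by simp) ?_ ?_ hv
  · rintro v (⟨j, k, rfl⟩ | ⟨j, rfl⟩)
    · simpa [sub_dotProduct] using hS.2 j k
    · simpa using hS.nonneg hp j
  · intro x y _ _ hx hy
    rw [add_dotProduct]
    exact add_nonneg hx hy
  · intro a x _ hx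
    change 0 ≤ ((a : ℝ) • x) ⬝ᵥ S
    rw [smul_dotProduct]
    exact mul_nonneg a.2 hx

lemma eq_sum_smul_single (v : Fin d → ℝ) : v = ∑ j, v j • (Pi.single j 1 : Fin d → ℝ) := by
  ext k
  simp [Finset.sum_apply, Pi.single_apply]

/-- Every position becomes solvent once enough units of one asset are added. -/
lemma add_smul_single_mem_solvencyCone (hp : IsBidAskMatrix p) (i : Fin d) (v : Fin d → ℝ) {c : ℝ}
    (hc : ∑ j, |v j| * p i j ≤ c) :
    v + c • (Pi.single i 1 : Fin d → ℝ) ∈ solvencyCone p := by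
  have hsplit : v + c • (Pi.single i 1 : Fin d → ℝ) =
      ∑ j, (v j • (Pi.single j 1 : Fin d → ℝ) + (|v j| * p i j) • (Pi.single i 1 : Fin d → ℝ)) +
        (c - ∑ j, |v j| * p i j) • (Pi.single i 1 : Fin d → ℝ) := by
    rw [Finset.sum_add_distrib, ← eq_sum_smul_single, ← Finset.sum_smul, add_assoc, ← add_smul]
    congr 2
    ring
  rw [hsplit]
  refine add_mem (sum_mem fun j _ => ?_)
    (smul_mem_solvencyCone (single_mem_solvencyCone i) (sub_nonneg.2 hc))
  rcases le_total 0 (v j) with h | h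
  · exact add_mem (smul_mem_solvencyCone (single_mem_solvencyCone j) h)
      (smul_mem_solvencyCone (single_mem_solvencyCone i)
        (mul_nonneg (abs_nonneg _) (hp.pos i j).le))
  -- A debt in asset `j` is paid off by exchanging asset `i` into `j`.
  · have := smul_mem_solvencyCone (exchange_mem_solvencyCone (p := p) i j) (neg_nonneg.2 h)
    rw [abs_of_nonpos h]
    convert this using 1
    module

lemma single_mem_interior_solvencyCone (hp : IsBidAskMatrix p) (i : Fin d) :
    (Pi.single i 1 : Fin d → ℝ) ∈ interior (solvencyCone p : Set (Fin d → ℝ)) := by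
  refine mem_interior.2
    ⟨{v | ∑ j, |v j - (Pi.single i 1 : Fin d → ℝ) j| * p i j < 1}, ?_, ?_, ?_⟩
  · intro v hv
    have := add_smul_single_mem_solvencyCone hp i (v - Pi.single i 1) (c := 1) hv.le
    rwa [one_smul, sub_add_cancel] at this
  · exact isOpen_lt (by fun_prop) continuous_const
  · simp

/-- A position with a positive value under all consistent prices is solvent. -/
lemma mem_solvencyCone_of_forall_pos (hp : IsBidAskMatrix p) (i : Fin d) {z : Fin d → ℝ}
    (hz : ∀ S, IsConsistentPrice p i S → 0 < z ⬝ᵥ S) : z ∈ solvencyCone p := by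
  by_contra hmem
  -- Separating via an interior point needs no closedness of the cone; the weak inequality obtained
  -- is still refuted by the strict `hz`.
  obtain ⟨f, hf0, hf⟩ := geometric_hahn_banach_of_nonempty_interior_point
    (solvencyCone p).convex (fun h => hmem (interior_subset h))
    ⟨_, single_mem_interior_solvencyCone hp i⟩
  have hfz : 0 ≤ f z := by simpa using hf 0 (zero_mem _)
  have hneg : ∀ k ∈ solvencyCone p, f k ≤ 0 := by
    intro k hk
    by_contra! hpos
    -- On this multiple of `k` the functional equals `f z + f k > f z`.
    have := hf ((f z / f k + 1) • k)
      (smul_mem_solvencyCone hk (by positivity))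
    rw [map_smul, smul_eq_mul, add_mul, div_mul_cancel₀ _ hpos.ne'] at this
    linarith
  have hdot : ∀ v, f v = ∑ j, v j * f (Pi.single j 1) := by
    intro v
    conv_lhs => rw [eq_sum_smul_single v]
    simp only [map_sum, map_smul, smul_eq_mul]
  set S : Fin d → ℝ := fun j => -f (Pi.single j 1) with hSdef
  have hS0 : ∀ j, 0 ≤ S j := fun j => by
    simpa [S] using hneg _ (single_mem_solvencyCone j)
  have hSle : ∀ j k, S k ≤ p j k * S j := fun j k => by
    have := hneg _ (exchange_mem_solvencyCone (p := p) j k)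
    rw [map_sub, map_smul, smul_eq_mul] at this
    simp only [S]
    linarith
  -- If `S i = 0`, then `S j ≤ p i j * S i` forces `f = 0`; otherwise `S` can be normalised.
  rcases (hS0 i).eq_or_lt with h0 | hpos
  · apply hf0
    ext v
    have hz0 : ∀ j, f (Pi.single j 1) = 0 := fun j => by
      have h1 := hSle i j
      rw [← h0, mul_zero] at h1
      have := le_antisymm h1 (hS0 j)
      simpa [S] using this
    rw [hdot]
    simp [hz0]
  · have hc : IsConsistentPrice p i ((S i)⁻¹ • S) := by
      refine ⟨by simp [hpos.ne'], fun j k => ?_⟩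
      simp only [Pi.smul_apply, smul_eq_mul]
      rw [mul_left_comm]
      exact mul_le_mul_of_nonneg_left (hSle j k) (inv_nonneg.2 hpos.le)
    have h1 := hz _ hc
    have h2 : z ⬝ᵥ S = -f z := by
      rw [hdot]
      simp [dotProduct, S]
    rw [dotProduct_smul, h2, smul_eq_mul] at h1
    have := inv_pos.2 hpos
    nlinarith

end BidAsk

/-! ### Hypographs: separation and attained maxima. -/

section Hypograph

lemma mem_hypograph_toReal {E : Type*} {g : E → EReal} {x : E} (h1 : g x ≠ ⊥) (h2 : g x ≠ ⊤) :
    (x, (g x).toReal) ∈ hypograph g := by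
  simp [hypograph, EReal.coe_toReal h2 h1]

lemma ne_top_of_forall_le_coe {E : Type*} {g : E → EReal} {c : ℝ} (hc : ∀ x, g x ≤ c) (x : E) :
    g x ≠ ⊤ :=
  ((hc x).trans_lt (EReal.coe_lt_top c)).ne

lemma lt_coe_of_hypograph {E : Type*} {g : E → EReal} {c : ℝ} (hc : ∀ x, g x ≤ c) {x : E}
    {a : ℝ} (h : ∀ r, (x, r) ∈ hypograph g → r < a) : g x < a := by
  by_cases hb : g x = ⊥
  · simp [hb]
  · have ht := ne_top_of_forall_le_coe hc x
    rw [← EReal.coe_toReal ht hb]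
    exact EReal.coe_lt_coe (h _ (mem_hypograph_toReal hb ht))

lemma le_coe_of_hypograph {E : Type*} {g : E → EReal} {x : E} {a : ℝ}
    (h : ∀ r, (x, r) ∈ hypograph g → r ≤ a) : g x ≤ a := by
  by_cases hb : g x = ⊥
  · simp [hb]
  by_cases ht : g x = ⊤
  · have := h (a + 1) (by simp [hypograph, ht])
    linarith
  · rw [← EReal.coe_toReal ht hb]
    exact EReal.coe_le_coe (h _ (mem_hypograph_toReal hb ht))

lemma le_of_hypograph_subset {E : Type*} {f g : E → EReal} (h : hypograph f ⊆ hypograph g)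
    (x : E) : f x ≤ g x :=
  EReal.ge_of_forall_gt_iff_ge.1 fun r hr => h (show ((x, r) : E × ℝ) ∈ hypograph f from hr.le)

/-- If `g` is strictly below the price functional of `x` at all consistent prices, then some
portfolio `y` obtained from `x` by trading has a price functional strictly above `g`. -/
lemma exists_trade_forall_lt {d : ℕ} {p : Matrix (Fin d) (Fin d) ℝ} (hp : IsBidAskMatrix p)
    (i : Fin d) {g : (Fin d → ℝ) → EReal} (hconv : Convex ℝ (hypograph g))
    (hclosed : IsClosed (hypograph g)) (hdom : ∀ S, g S ≠ ⊥ → S i = 1) {c : ℝ}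
    (hc : ∀ S, g S ≤ c) {x : Fin d → ℝ}
    (hx : ∀ S, IsConsistentPrice p i S → g S < ((x ⬝ᵥ S : ℝ) : EReal)) :
    ∃ y : Fin d → ℝ, (∀ S, g S < ((y ⬝ᵥ S : ℝ) : EReal)) ∧ x - y ∈ solvencyCone p := by
  have hdom' : ∀ q ∈ hypograph g, q.1 i = 1 := fun q hq =>
    hdom _ fun hb => by simp [hypograph, hb] at hq
  have hc' : ∀ q ∈ hypograph g, q.2 ≤ c := fun q hq => by
    exact_mod_cast (show ((q.2 : ℝ) : EReal) ≤ g q.1 from hq).trans (hc q.1)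
  rcases (hypograph g).eq_empty_or_nonempty with hemp | ⟨⟨S₀, r₀⟩, hmem₀⟩
  · refine ⟨x, fun S => lt_coe_of_hypograph hc fun r hr => ?_, by simp⟩
    simp [hemp] at hr
  have hK := isCompact_setOf_isConsistentPrice hp i
  have hcont : Continuous fun S : Fin d → ℝ => x ⬝ᵥ S := by
    unfold dotProduct
    fun_prop
  have hGconv : Convex ℝ ((fun S => (S, x ⬝ᵥ S)) '' {S | IsConsistentPrice p i S}) := by
    rintro _ ⟨S, hS, rfl⟩ _ ⟨S', hS', rfl⟩ a b ha hb hab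
    exact ⟨a • S + b • S', convex_setOf_isConsistentPrice p i hS hS' ha hb hab, by
      simp [dotProduct_add, dotProduct_smul]⟩
  have hdisj : Disjoint ((fun S => (S, x ⬝ᵥ S)) '' {S | IsConsistentPrice p i S})
      (hypograph g) := by
    rw [Set.disjoint_left]
    rintro _ ⟨S, hS, rfl⟩ hmem
    exact absurd (hx S hS) (not_lt.2 hmem)
  obtain ⟨f, u, v, hfu, huv, hfv⟩ := geometric_hahn_banach_compact_closed hGconv
    (hK.image (by fun_prop)) hconv hclosed hdisj
  -- a lower bound for `x ⬝ᵥ S` on the consistent prices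
  obtain ⟨m, hm⟩ := (hK.image hcont).bddBelow
  have hm' : ∀ S, IsConsistentPrice p i S → m ≤ x ⬝ᵥ S := fun S hS => hm ⟨S, hS, rfl⟩
  set l : ℝ := f (0, 1) with hl
  set φ : Fin d → ℝ := fun j => f (Pi.single j 1, 0) with hφ
  have hf : ∀ S r, f (S, r) = φ ⬝ᵥ S + r * l := by
    intro S r
    have h1 : ((S, r) : (Fin d → ℝ) × ℝ) =
        ∑ j, S j • ((Pi.single j 1 : Fin d → ℝ), (0 : ℝ)) + r • ((0 : Fin d → ℝ), (1 : ℝ)) := by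
      refine Prod.ext ?_ ?_
      · ext k
        simp [Prod.fst_sum, Finset.sum_apply, Pi.single_apply]
      · simp [Prod.snd_sum]
    rw [h1, map_add, map_sum, map_smul]
    simp only [map_smul, smul_eq_mul, dotProduct, φ, l]
    congr 1
    exact Finset.sum_congr rfl fun j _ => mul_comm _ _
  -- Hypographs are closed under moving down, so `l > 0` would push `f` below `v`.
  have hl0 : l ≤ 0 := by
    by_contra! hpos
    have hdown : (S₀, min r₀ ((v - φ ⬝ᵥ S₀) / l)) ∈ hypograph g :=
      le_trans (EReal.coe_le_coe (min_le_left _ _)) hmem₀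
    have h1 := hfv _ hdown
    rw [hf] at h1
    have h2 := mul_le_mul_of_nonneg_right (min_le_right r₀ ((v - φ ⬝ᵥ S₀) / l)) hpos.le
    rw [div_mul_cancel₀ _ hpos.ne'] at h2
    linarith
  -- tilt the separating functional so that it is not vertical
  obtain ⟨η, hη, hη'⟩ : ∃ η : ℝ, 0 < η ∧ u - η * m < v - η * c := by
    refine ⟨(v - u) / (2 * (|c - m| + 1)), by
      have := sub_pos.2 huv
      positivity, ?_⟩
    have h1 : (v - u) / (2 * (|c - m| + 1)) * (|c - m| + 1) = (v - u) / 2 := by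
      field_simp
    have h2 : 0 < (v - u) / (2 * (|c - m| + 1)) := by
      have := sub_pos.2 huv
      positivity
    nlinarith [le_abs_self (c - m)]
  have hlη : 0 < η - l := by linarith
  -- The tilted functional `φ ⬝ᵥ S + (l - η) * r` is below `w` on the graph and above `w` on the
  -- hypograph. Solving for `r` at level `w` gives the portfolio; the constant `w` goes into
  -- coordinate `i`, since `S i = 1`.
  set w : ℝ := u - η * m with hw
  refine ⟨(η - l)⁻¹ • (φ - w • Pi.single i 1), fun S => lt_coe_of_hypograph hc fun r hr => ?_,
    mem_solvencyCone_of_forall_pos hp i fun S hS => ?_⟩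
  · have h1 := hfv _ hr
    have h2 := hdom' _ hr
    have h3 := hc' _ hr
    simp only at h2 h3
    rw [hf] at h1
    rw [smul_dotProduct, smul_eq_mul, inv_mul_eq_div, lt_div_iff₀ hlη, sub_dotProduct,
      smul_dotProduct]
    simp only [single_dotProduct, h2, smul_eq_mul, mul_one]
    nlinarith
  · have h1 := hfu _ ⟨S, hS, rfl⟩
    have h2 := hm' S hS
    simp only [hf] at h1
    rw [sub_dotProduct, smul_dotProduct, smul_eq_mul, inv_mul_eq_div, sub_pos, div_lt_iff₀ hlη,
      sub_dotProduct, smul_dotProduct]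
    simp only [single_dotProduct, hS.1, smul_eq_mul, mul_one]
    nlinarith

/-- A nonempty closed hypograph that is bounded above and lies over a compact set has a highest
point. -/
lemma exists_isGreatest_range {E : Type*} [TopologicalSpace E] {g : E → EReal} {K : Set E}
    (hK : IsCompact K) (hclosed : IsClosed (hypograph g)) (hdom : ∀ x, g x ≠ ⊥ → x ∈ K) {c : ℝ}
    (hc : ∀ x, g x ≤ c) {x₀ : E} (hx₀ : g x₀ ≠ ⊥) :
    ∃ r : ℝ, IsGreatest (range g) (r : EReal) := by
  have ht := ne_top_of_forall_le_coe hc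
  set r₀ := (g x₀).toReal
  have hcomp : IsCompact (hypograph g ∩ K ×ˢ Icc r₀ c) :=
    (hK.prod isCompact_Icc).inter_left hclosed
  have hin : ∀ x, g x ≠ ⊥ → r₀ ≤ (g x).toReal →
      (x, (g x).toReal) ∈ hypograph g ∩ K ×ˢ Icc r₀ c := fun x hx hr =>
    ⟨mem_hypograph_toReal hx (ht x), hdom x hx, hr, by
      rw [← EReal.coe_le_coe_iff, EReal.coe_toReal (ht x) hx]; exact hc x⟩
  obtain ⟨⟨x, r⟩, hmem, hmax⟩ := hcomp.exists_isMaxOn ⟨_, hin x₀ hx₀ le_rfl⟩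
    continuous_snd.continuousOn
  have hle : ∀ y, g y ≤ r := by
    intro y
    by_cases hy : g y = ⊥
    · simp [hy]
    rw [← EReal.coe_toReal (ht y) hy, EReal.coe_le_coe_iff]
    by_cases hr : r₀ ≤ (g y).toReal
    · exact hmax (hin y hy hr)
    · exact (not_le.1 hr).le.trans hmem.2.2.1
  refine ⟨r, ⟨x, le_antisymm (hle x) hmem.1⟩, ?_⟩
  rintro _ ⟨y, rfl⟩
  exact hle y

end Hypograph

/-! ### Atoms of a σ-algebra on a countable space. -/

section Atoms

variable {Ω β : Type*} {m : MeasurableSpace Ω}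

lemma subset_of_mem_sigmaAtoms {A B : Set Ω} (hA : A ∈ sigmaAtoms m) (hB : MeasurableSet[m] B)
    {ω : Ω} (hωA : ω ∈ A) (hωB : ω ∈ B) : A ⊆ B := by
  rcases hA.2.2 (A ∩ B) (hA.1.inter hB) inter_subset_left with h | h
  · exact absurd (h ▸ ⟨hωA, hωB⟩ : ω ∈ (∅ : Set Ω)) (notMem_empty ω)
  · exact inter_eq_left.1 h

lemma eq_of_mem_sigmaAtoms [MeasurableSpace β] [MeasurableSingletonClass β] {f : Ω → β}
    (hf : Measurable[m] f) {A : Set Ω} (hA : A ∈ sigmaAtoms m) {ω ω' : Ω} (hω : ω ∈ A)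
    (hω' : ω' ∈ A) : f ω = f ω' :=
  (subset_of_mem_sigmaAtoms hA (hf (measurableSet_singleton (f ω))) hω rfl hω').symm

/-- Gives the node through each `ω` as a function of `ω`, as needed to build adapted processes. -/
lemma measurableAtom_mem_sigmaAtoms [Countable Ω] (m : MeasurableSpace Ω) (ω : Ω) :
    measurableAtom ω ∈ sigmaAtoms m := by
  refine ⟨MeasurableSet.measurableAtom_of_countable ω, ⟨ω, mem_measurableAtom_self ω⟩,
    fun B hB hsub => ?_⟩
  by_cases hω : ω ∈ B
  · exact Or.inr (hsub.antisymm (measurableAtom_subset hB hω))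
  · refine Or.inl (eq_empty_of_forall_notMem fun x hx => ?_)
    exact measurableAtom_subset hB.compl hω (hsub hx) hx

lemma measurable_of_forall_measurableAtom [Countable Ω] [MeasurableSpace β] {f : Ω → β}
    (hf : ∀ ω, ∀ ω' ∈ measurableAtom ω, f ω' = f ω) : Measurable f := by
  intro s _
  have : f ⁻¹' s = ⋃ ω ∈ f ⁻¹' s, measurableAtom ω := by
    ext ω
    simp only [mem_iUnion, exists_prop]
    refine ⟨fun h => ⟨ω, h, mem_measurableAtom_self ω⟩, ?_⟩
    rintro ⟨ω', h, h'⟩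
    rw [mem_preimage, hf _ _ h']
    exact h
  rw [this]
  exact MeasurableSet.biUnion (to_countable _) fun ω _ =>
    MeasurableSet.measurableAtom_of_countable ω

end Atoms

lemma forall_of_ae_of_forall_singleton_pos {Ω : Type*} [MeasurableSpace Ω] {P : Measure Ω}
    (hP : ∀ ω, 0 < P {ω}) {q : Ω → Prop} (h : ∀ᵐ ω ∂P, q ω) (ω : Ω) : q ω := by
  by_contra hω
  have h1 : P {ω} ≤ P {ω | ¬ q ω} := measure_mono (by simpa using hω)
  rw [ae_iff.1 h] at h1
  exact (hP ω).not_ge h1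

/-! ### Strategies, and bounds linking them to the value functions. -/

namespace Market

variable {Ω : Type*} [MeasurableSpace Ω] {d T : ℕ} {M : Market Ω d T}

section Basic

lemma univ_mem_nodes_zero [Nonempty Ω] (M : Market Ω d T) : univ ∈ M.nodes 0 := by
  refine ⟨MeasurableSet.univ, univ_nonempty, fun B hB _ => ?_⟩
  rw [M.zero_trivial] at hB
  exact MeasurableSpace.measurableSet_bot_iff.1 hB

lemma bidAsk_eq {t : ℕ} (ht : t ≤ T) {A : Set Ω} (hA : A ∈ M.nodes t) {ω ω' : Ω} (hω : ω ∈ A)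
    (hω' : ω' ∈ A) : M.bidAsk t ω = M.bidAsk t ω' := by
  ext j k
  exact eq_of_mem_sigmaAtoms (M.adapted t ht j k) hA hω hω'

lemma measurable_last {β : Type*} [MeasurableSpace β] {X : Ω → β} (M : Market Ω d T)
    (hX : Measurable X) : Measurable[M.ℱ T] X := by
  rw [M.last_eq]
  exact hX

variable {P : Measure Ω}

/-- Superhedging strategies, written with the initial endowment included in the positions. -/
lemma sub_mem_attainable_iff (hP : ∀ ω : Ω, 0 < P {ω}) {X : Ω → Fin d → ℝ} (hX : Measurable X)
    (x : Fin d → ℝ) :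
    (fun ω => X ω - x) ∈ M.attainable P ↔
      ∃ Y : ℕ → Ω → Fin d → ℝ, (∀ t ≤ T, Measurable[M.ℱ t] (Y t)) ∧
        (∀ ω, x - Y 0 ω ∈ M.cone 0 ω) ∧
        (∀ t < T, ∀ ω, Y t ω - Y (t + 1) ω ∈ M.cone (t + 1) ω) ∧ ∀ ω, Y T ω = X ω := by
  constructor
  · rintro ⟨-, V, ⟨hV, h0, hstep⟩, hXV⟩
    refine ⟨fun t ω => V t ω + x, fun t ht => (hV t ht).add_const x, fun ω => ?_,
      fun t ht ω => ?_, fun ω => ?_⟩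
    · simpa using forall_of_ae_of_forall_singleton_pos hP h0 ω
    · simpa using forall_of_ae_of_forall_singleton_pos hP (hstep t ht) ω
    · have := forall_of_ae_of_forall_singleton_pos hP hXV ω
      simp only [← this, sub_add_cancel]
  · rintro ⟨Y, hY, h0, hstep, hT⟩
    refine ⟨hX.sub_const x, fun t ω => Y t ω - x, ⟨fun t ht => (hY t ht).sub_const x,
      Filter.Eventually.of_forall fun ω => ?_,
      fun t ht => Filter.Eventually.of_forall fun ω => ?_⟩,
      Filter.Eventually.of_forall fun ω => ?_⟩
    · simpa using h0 ω
    · simpa using hstep t ht ω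
    · simp [hT]

/-- A solvent surplus can be traded away at time `T`: only the last position changes, and its
increment stays in the cone by additivity. -/
lemma attainable_of_sub_mem_cone (hP : ∀ ω : Ω, 0 < P {ω}) {Y Z : Ω → Fin d → ℝ}
    (hY : Y ∈ M.attainable P) (hZ : Measurable Z) (h : ∀ ω, Y ω - Z ω ∈ M.cone T ω) :
    Z ∈ M.attainable P := by
  obtain ⟨-, V, ⟨hV, h0, hstep⟩, hYV⟩ := hY
  have hYV' := forall_of_ae_of_forall_singleton_pos hP hYV
  refine ⟨hZ, fun t => if t = T then Z else V t, ⟨fun t ht => ?_, ?_, fun t ht => ?_⟩, by simp⟩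
  · by_cases hT : t = T
    · subst hT
      simpa using M.measurable_last hZ
    · simpa [hT] using hV t ht
  · filter_upwards [h0] with ω hω
    -- For `T = 0` the initial trade is also the last one.
    by_cases hT : 0 = T
    · subst hT
      have := add_mem hω (h ω)
      rw [hYV' ω, neg_add_eq_sub, sub_sub_cancel_left] at this
      simpa using this
    · simpa [hT] using hω
  · filter_upwards [hstep t ht] with ω hω
    by_cases hT : t + 1 = T
    · subst hT
      have := add_mem hω (h ω)
      rw [hYV' ω] at this
      simpa [ht.ne, add_comm, sub_eq_add_neg, add_assoc, add_left_comm] using this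
    · simpa [hT, ht.ne] using hω

end Basic

namespace IsScalarAlgorithm

variable {X : Ω → Fin d → ℝ} {i : Fin d} {V W : ℕ → Set Ω → (Fin d → ℝ) → EReal}

lemma truncated_eq (h : M.IsScalarAlgorithm X i V W) {t : ℕ} (ht : t ≤ T) {A : Set Ω}
    (hA : A ∈ M.nodes t) {ω : Ω} (hω : ω ∈ A) {S : Fin d → ℝ}
    (hS : IsConsistentPrice (M.bidAsk t ω) i S) : W t A S = V t A S := by
  rcases ht.eq_or_lt with rfl | hlt
  · rw [h.terminal_eq A hA]
  · exact h.cut_pos t hlt A hA ω hω S hS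

lemma truncated_eq_bot (h : M.IsScalarAlgorithm X i V W) {t : ℕ} (ht : t ≤ T) {A : Set Ω}
    (hA : A ∈ M.nodes t) {ω : Ω} (hω : ω ∈ A) {S : Fin d → ℝ}
    (hS : ¬ IsConsistentPrice (M.bidAsk t ω) i S) : W t A S = ⊥ := by
  rcases ht.eq_or_lt with rfl | hlt
  · rw [h.terminal_eq A hA]
    exact h.terminal_neg A hA ω hω S hS
  · exact h.cut_neg t hlt A hA ω hω S hS

lemma truncated_le (h : M.IsScalarAlgorithm X i V W) {t : ℕ} (ht : t ≤ T) {A : Set Ω}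
    (hA : A ∈ M.nodes t) (S : Fin d → ℝ) : W t A S ≤ V t A S := by
  obtain ⟨ω, hω⟩ := hA.2.1
  by_cases hS : IsConsistentPrice (M.bidAsk t ω) i S
  · rw [h.truncated_eq ht hA hω hS]
  · rw [h.truncated_eq_bot ht hA hω hS]
    exact bot_le

lemma hypograph_truncated (h : M.IsScalarAlgorithm X i V W) {t : ℕ} (ht : t ≤ T) {A : Set Ω}
    (hA : A ∈ M.nodes t) {ω : Ω} (hω : ω ∈ A) :
    hypograph (W t A) =
      hypograph (V t A) ∩ {S | IsConsistentPrice (M.bidAsk t ω) i S} ×ˢ univ := by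
  ext ⟨S, r⟩
  by_cases hS : IsConsistentPrice (M.bidAsk t ω) i S
  · simp [hypograph, hS, h.truncated_eq ht hA hω hS]
  · simp [hypograph, hS, h.truncated_eq_bot ht hA hω hS]

/-- Passes strict domination from a node to its successors in the forward construction. -/
lemma truncated_le_succ (h : M.IsScalarAlgorithm X i V W) {t : ℕ} (ht : t < T) {A B : Set Ω}
    (hA : A ∈ M.nodes t) (hB : B ∈ M.nodes (t + 1)) (hBA : B ⊆ A) (S : Fin d → ℝ) :
    W (t + 1) B S ≤ V t A S := by
  refine le_of_hypograph_subset ?_ S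
  have hcap := h.cap t ht A hA
  unfold IsConcaveCap at hcap
  rw [hcap]
  have hmem : B ∈ M.succNodes t A := ⟨hB, hBA⟩
  exact (subset_biUnion_of_mem (u := fun B => hypograph (W (t + 1) B)) hmem).trans
    ((subset_convexHull ℝ _).trans subset_closure)

lemma hypograph_terminal (h : M.IsScalarAlgorithm X i V W) {A : Set Ω} (hA : A ∈ M.nodes T)
    {ω : Ω} (hω : ω ∈ A) :
    hypograph (V T A) = {q | IsConsistentPrice (M.bidAsk T ω) i q.1 ∧ q.2 ≤ X ω ⬝ᵥ q.1} := by
  ext ⟨S, r⟩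
  by_cases hS : IsConsistentPrice (M.bidAsk T ω) i S
  · simp [hypograph, hS, h.terminal_pos A hA ω hω S hS]
  · simp [hypograph, hS, h.terminal_neg A hA ω hω S hS]

/-- The value functions are concave, upper semicontinuous, uniformly bounded above, and finite
only at price vectors with numéraire `i`. -/
lemma exists_bound [Finite Ω] (h : M.IsScalarAlgorithm X i V W) :
    ∃ c : ℝ, ∀ t ≤ T, ∀ A ∈ M.nodes t, Convex ℝ (hypograph (V t A)) ∧
      IsClosed (hypograph (V t A)) ∧ (∀ S, V t A S ≠ ⊥ → S i = 1) ∧ ∀ S, V t A S ≤ c := by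
  have hcont : ∀ ω, Continuous fun S : Fin d → ℝ => X ω ⬝ᵥ S := fun ω => by
    unfold dotProduct
    fun_prop
  have hcomp : ∀ ω, IsCompact {S | IsConsistentPrice (M.bidAsk T ω) i S} := fun ω =>
    isCompact_setOf_isConsistentPrice (M.isBidAsk T le_rfl ω) i
  choose b hb using fun ω => ((hcomp ω).image (hcont ω)).bddAbove
  obtain ⟨c, hc⟩ := (finite_range b).bddAbove
  have hbound : ∀ ω S, IsConsistentPrice (M.bidAsk T ω) i S → X ω ⬝ᵥ S ≤ c := fun ω S hS =>
    (hb ω ⟨S, hS, rfl⟩).trans (hc ⟨ω, rfl⟩)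
  refine ⟨c, ?_⟩
  -- The invariant places the hypograph inside a closed convex set, so it survives closed convex
  -- hulls.
  suffices H : ∀ n t, t + n = T → ∀ A ∈ M.nodes t, Convex ℝ (hypograph (V t A)) ∧
      IsClosed (hypograph (V t A)) ∧
      hypograph (V t A) ⊆ {q | q.1 i = 1} ∩ {q | q.2 ≤ c} by
    intro t ht A hA
    obtain ⟨h1, h2, h3⟩ := H (T - t) t (by omega) A hA
    have hle : ∀ S, V t A S ≤ c := fun S => le_coe_of_hypograph fun r hr => (h3 hr).2
    exact ⟨h1, h2, fun S hS =>
      (h3 (mem_hypograph_toReal hS (ne_top_of_forall_le_coe hle S))).1, hle⟩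
  intro n
  induction n with
  | zero =>
    intro t ht A hA
    obtain rfl : t = T := by omega
    obtain ⟨ω, hω⟩ := hA.2.1
    rw [h.hypograph_terminal hA hω]
    refine ⟨?_, ?_, fun q hq => ⟨hq.1.1, hq.2.trans (hbound ω _ hq.1)⟩⟩
    · intro q hq q' hq' a b ha hb hab
      refine ⟨convex_setOf_isConsistentPrice _ i hq.1 hq'.1 ha hb hab, ?_⟩
      simp only [Prod.snd_add, Prod.smul_snd, Prod.fst_add, Prod.smul_fst, dotProduct_add,
        dotProduct_smul, smul_eq_mul]
      exact add_le_add (mul_le_mul_of_nonneg_left hq.2 ha) (mul_le_mul_of_nonneg_left hq'.2 hb)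
    · exact ((hcomp ω).isClosed.preimage continuous_fst).inter
        (isClosed_le continuous_snd ((hcont ω).comp continuous_fst))
  | succ n ih =>
    intro t ht A hA
    have hcap := h.cap t (by omega) A hA
    unfold IsConcaveCap at hcap
    rw [hcap]
    refine ⟨(convex_convexHull ℝ _).closure, isClosed_closure, ?_⟩
    have hset : Convex ℝ ({q : (Fin d → ℝ) × ℝ | q.1 i = 1} ∩ {q | q.2 ≤ c}) := by
      refine Convex.inter ?_ ?_
      · intro q hq q' hq' a b _ _ hab
        simp only [mem_ofPred_eq] at hq hq' ⊢
        simp [hq, hq', hab]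
      · exact (convex_Iic c).linear_preimage (LinearMap.snd ℝ (Fin d → ℝ) ℝ)
    refine closure_minimal (convexHull_min (iUnion₂_subset fun B hB q hq => ?_) hset)
      ((isClosed_eq (by fun_prop) (by fun_prop)).inter (isClosed_le (by fun_prop) (by fun_prop)))
    exact (ih (t + 1) (by omega) B hB.1).2.2
      (le_trans hq (h.truncated_le (by omega) hB.1 q.1))

/-- The value functions are dominated by every superhedging strategy. -/
lemma le_dotProduct (h : M.IsScalarAlgorithm X i V W) {Y : ℕ → Ω → Fin d → ℝ}
    (hY : ∀ t ≤ T, Measurable[M.ℱ t] (Y t))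
    (hstep : ∀ t < T, ∀ ω, Y t ω - Y (t + 1) ω ∈ M.cone (t + 1) ω) (hT : ∀ ω, Y T ω = X ω)
    {t : ℕ} (ht : t ≤ T) {A : Set Ω} (hA : A ∈ M.nodes t) {ω : Ω} (hω : ω ∈ A)
    (S : Fin d → ℝ) : V t A S ≤ ((Y t ω ⬝ᵥ S : ℝ) : EReal) := by
  suffices H : ∀ n t, t + n = T → ∀ A ∈ M.nodes t, ∀ ω ∈ A, ∀ S,
      V t A S ≤ ((Y t ω ⬝ᵥ S : ℝ) : EReal) from H (T - t) t (by omega) A hA ω hω S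
  clear! t S
  intro n
  induction n with
  | zero =>
    intro t ht A hA ω hω S
    obtain rfl : t = T := by omega
    refine le_coe_of_hypograph fun r hr => ?_
    rw [h.hypograph_terminal hA hω] at hr
    simpa [← hT] using hr.2
  | succ n ih =>
    intro t ht A hA ω hω S
    refine le_coe_of_hypograph fun r hr => ?_
    have hcap := h.cap t (by omega) A hA
    unfold IsConcaveCap at hcap
    rw [hcap] at hr
    have hset : Convex ℝ {q : (Fin d → ℝ) × ℝ | q.2 ≤ Y t ω ⬝ᵥ q.1} := by
      intro q hq q' hq' a b ha hb hab
      simp only [mem_ofPred_eq, Prod.snd_add, Prod.smul_snd, Prod.fst_add, Prod.smul_fst,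
        dotProduct_add, dotProduct_smul, smul_eq_mul]
      exact add_le_add (mul_le_mul_of_nonneg_left hq ha) (mul_le_mul_of_nonneg_left hq' hb)
    have hcont : Continuous fun q : (Fin d → ℝ) × ℝ => Y t ω ⬝ᵥ q.1 := by
      unfold dotProduct
      fun_prop
    refine closure_minimal (convexHull_min (iUnion₂_subset fun B hB => ?_) hset)
      (isClosed_le continuous_snd hcont) hr
    rintro ⟨S', r'⟩ hq
    obtain ⟨ω', hω'⟩ := hB.1.2.1
    have hmem := h.hypograph_truncated (by omega) hB.1 hω' ▸ hq
    have h1 : r' ≤ Y (t + 1) ω' ⬝ᵥ S' := by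
      exact_mod_cast (show (r' : EReal) ≤ _ from hmem.1).trans
        (ih (t + 1) (by omega) B hB.1 ω' hω' S')
    have h2 := IsConsistentPrice.dotProduct_nonneg (M.isBidAsk (t + 1) (by omega) ω') hmem.2.1
      (hstep t (by omega) ω')
    rw [sub_dotProduct] at h2
    -- Adaptedness: one portfolio must serve all successors of `A`.
    have h3 : Y t ω = Y t ω' := eq_of_mem_sigmaAtoms (hY t (by omega)) hA hω (hB.2 hω')
    simp only [mem_ofPred_eq, h3]
    linarith

/-- A portfolio that is more expensive than the truncated value at the initial node is the
beginning of a superhedging strategy. -/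
lemma exists_strategy [Finite Ω] [Nonempty Ω] (h : M.IsScalarAlgorithm X i V W)
    (hX : Measurable X) {x : Fin d → ℝ}
    (hx : ∀ S, W 0 univ S < ((x ⬝ᵥ S : ℝ) : EReal)) :
    ∃ Y : ℕ → Ω → Fin d → ℝ, (∀ t ≤ T, Measurable[M.ℱ t] (Y t)) ∧
      (∀ ω, x - Y 0 ω ∈ M.cone 0 ω) ∧
      (∀ t < T, ∀ ω, Y t ω - Y (t + 1) ω ∈ M.cone (t + 1) ω) ∧ ∀ ω, Y T ω = X ω := by
  obtain ⟨c, hc⟩ := h.exists_bound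
  -- The hypotheses sit inside the existential so that `choose` yields a total trading rule. At `T`
  -- the rule lands on `X`, so strict domination is claimed only for `t < T`.
  have hstep : ∀ (t : ℕ) (A : Set Ω) (x : Fin d → ℝ), ∃ y : Fin d → ℝ,
      t ≤ T → A ∈ M.nodes t → (∀ S, W t A S < ((x ⬝ᵥ S : ℝ) : EReal)) →
        (t < T → ∀ S, V t A S < ((y ⬝ᵥ S : ℝ) : EReal)) ∧ (t = T → ∀ ω ∈ A, y = X ω) ∧
        ∀ ω ∈ A, x - y ∈ M.cone t ω := by
    intro t A x
    by_cases hcond : t ≤ T ∧ A ∈ M.nodes t ∧ ∀ S, W t A S < ((x ⬝ᵥ S : ℝ) : EReal)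
    swap
    · exact ⟨0, fun h1 h2 h3 => absurd ⟨h1, h2, h3⟩ hcond⟩
    obtain ⟨ht, hA, hx⟩ := hcond
    obtain ⟨ω, hω⟩ := hA.2.1
    have hp := M.isBidAsk t ht ω
    have hcone : ∀ ω' ∈ A, M.cone t ω' = M.cone t ω := fun ω' hω' => by
      unfold Market.cone
      rw [bidAsk_eq ht hA hω' hω]
    rcases ht.eq_or_lt with rfl | hlt
    · refine ⟨X ω, fun _ _ _ => ⟨fun hlt => absurd hlt (lt_irrefl _), fun _ ω' hω' =>
        eq_of_mem_sigmaAtoms (M.measurable_last hX) hA hω hω', fun ω' hω' => ?_⟩⟩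
      rw [hcone ω' hω']
      refine mem_solvencyCone_of_forall_pos hp i fun S hS => ?_
      have := hx S
      rw [h.terminal_eq A hA, h.terminal_pos A hA ω hω S hS, EReal.coe_lt_coe_iff] at this
      rw [sub_dotProduct]
      linarith
    · obtain ⟨h1, h2, h3, h4⟩ := hc t ht A hA
      obtain ⟨y, hy, hxy⟩ := exists_trade_forall_lt hp i h1 h2 h3 h4 (x := x) fun S hS => by
        rw [← h.truncated_eq ht hA hω hS]
        exact hx S
      refine ⟨y, fun _ _ _ => ⟨fun _ => hy, fun hT => absurd hT hlt.ne, fun ω' hω' => ?_⟩⟩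
      rw [hcone ω' hω']
      exact hxy
  choose step hstep using hstep
  let atom : ℕ → Ω → Set Ω := fun t ω => @measurableAtom Ω (M.ℱ t) ω
  have hatom : ∀ t ω, atom t ω ∈ M.nodes t := fun t ω => measurableAtom_mem_sigmaAtoms _ ω
  have hself : ∀ t ω, ω ∈ atom t ω := fun t ω => @mem_measurableAtom_self Ω (M.ℱ t) ω
  have hsucc : ∀ t ω, atom (t + 1) ω ⊆ atom t ω := fun t ω =>
    subset_of_mem_sigmaAtoms (hatom (t + 1) ω) (M.ℱ.mono t.le_succ _ (hatom t ω).1)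
      (hself _ ω) (hself _ ω)
  have heq : ∀ t ω, ∀ ω' ∈ atom t ω, atom t ω' = atom t ω := fun t ω ω' hω' =>
    (subset_of_mem_sigmaAtoms (hatom t ω') (hatom t ω).1 (hself t ω') hω').antisymm
      (subset_of_mem_sigmaAtoms (hatom t ω) (hatom t ω').1 hω' (hself t ω'))
  -- The rule is applied along the path of atoms containing `ω`.
  let Y : ℕ → Ω → Fin d → ℝ := fun t => Nat.rec (fun ω => step 0 (atom 0 ω) x)
    (fun t y ω => step (t + 1) (atom (t + 1) ω) (y ω)) t
  have hY0 : ∀ ω, Y 0 ω = step 0 (atom 0 ω) x := fun ω => rfl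
  have hYs : ∀ t ω, Y (t + 1) ω = step (t + 1) (atom (t + 1) ω) (Y t ω) := fun t ω => rfl
  have hconst : ∀ t ω, ∀ ω' ∈ atom t ω, Y t ω' = Y t ω := by
    intro t
    induction t with
    | zero => intro ω ω' hω'; rw [hY0, hY0, heq 0 ω ω' hω']
    | succ t ih => intro ω ω' hω'; rw [hYs, hYs, heq _ ω ω' hω', ih ω ω' (hsucc t ω hω')]
  have hzero : ∀ ω, atom 0 ω = univ := fun ω =>
    (subset_univ _).antisymm (subset_of_mem_sigmaAtoms M.univ_mem_nodes_zero (hatom 0 ω).1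
      (mem_univ ω) (hself 0 ω))
  have hspec0 := fun ω => hstep 0 (atom 0 ω) x (Nat.zero_le T) (hatom 0 ω)
    (by rw [hzero]; exact hx)
  have hlt : ∀ t < T, ∀ ω S, V t (atom t ω) S < ((Y t ω ⬝ᵥ S : ℝ) : EReal) := by
    intro t
    induction t with
    | zero => exact fun ht ω => (hspec0 ω).1 ht
    | succ t ih =>
      intro ht ω
      refine (hstep (t + 1) (atom (t + 1) ω) (Y t ω) ht.le (hatom _ ω) fun S => ?_).1 ht
      exact (h.truncated_le_succ (by omega) (hatom t ω) (hatom (t + 1) ω) (hsucc t ω) S).trans_lt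
        (ih (by omega) ω S)
  have hspec := fun t (ht : t < T) ω => hstep (t + 1) (atom (t + 1) ω) (Y t ω) ht (hatom _ ω)
    fun S => (h.truncated_le_succ ht (hatom t ω) (hatom (t + 1) ω) (hsucc t ω) S).trans_lt
      (hlt t ht ω S)
  refine ⟨Y, fun t _ => @measurable_of_forall_measurableAtom Ω _ (M.ℱ t) _ _ _ (hconst t),
    fun ω => (hspec0 ω).2.2 ω (hself 0 ω), fun t ht ω => (hspec t ht ω).2.2 ω (hself _ ω),
    fun ω => ?_⟩
  obtain h0 | ⟨t, ht⟩ : T = 0 ∨ ∃ t, T = t + 1 := by cases T <;> simp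
  · exact h0 ▸ (hspec0 ω).2.1 h0.symm ω (hself 0 ω)
  · rw [← (hspec t (by omega) ω).2.1 ht.symm ω (hself _ ω), ← hYs, ht]

end IsScalarAlgorithm

end Market

/-! ### Existence of concave caps. -/

section ConcaveCap

/-- The function whose hypograph is a given closed and downward closed set. -/
noncomputable def hypographSup {E : Type*} (C : Set (E × ℝ)) (x : E) : EReal :=
  ⨆ (r : ℝ) (_ : (x, r) ∈ C), (r : EReal)

/-- Downward closedness fills each vertical fibre below its supremum; closedness adds the endpoint.
-/
lemma hypograph_hypographSup {E : Type*} [TopologicalSpace E] {C : Set (E × ℝ)}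
    (hC : IsClosed C) (hdown : ∀ x r s, (x, r) ∈ C → s ≤ r → (x, s) ∈ C) :
    hypograph (hypographSup C) = C := by
  ext ⟨x, r⟩
  constructor
  · intro h
    have hlt : ∀ s < r, (x, s) ∈ C := by
      intro s hs
      have h1 : (s : EReal) < hypographSup C x := (EReal.coe_lt_coe hs).trans_le h
      obtain ⟨r', hr'⟩ := lt_iSup_iff.1 h1
      obtain ⟨hmem, hlt⟩ := lt_iSup_iff.1 hr'
      exact hdown x r' s hmem (EReal.coe_lt_coe_iff.1 hlt).le
    have hcl : IsClosed {s : ℝ | (x, s) ∈ C} := hC.preimage (by fun_prop)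
    have : Iic r ⊆ {s : ℝ | (x, s) ∈ C} := by
      rw [← closure_Iio r]
      exact closure_minimal hlt hcl
    exact this self_mem_Iic
  · intro h
    exact le_iSup₂_of_le (f := fun (r : ℝ) (_ : (x, r) ∈ C) => (r : EReal)) r h le_rfl

/-- A downward translation is affine and continuous, so it preserves first the convex hull, then its
closure. -/
lemma down_mem_closure_convexHull {E : Type*} [AddCommGroup E] [Module ℝ E] [TopologicalSpace E]
    {U : Set (E × ℝ)} (hU : ∀ x r s, (x, r) ∈ U → s ≤ r → (x, s) ∈ U) :
    ∀ x r s, (x, r) ∈ closure (convexHull ℝ U) → s ≤ r → (x, s) ∈ closure (convexHull ℝ U) := by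
  intro x r s h hs
  have hmap : ∀ q ∈ convexHull ℝ U, (q.1, q.2 - (r - s)) ∈ convexHull ℝ U := by
    have hconv : Convex ℝ {q : E × ℝ | (q.1, q.2 - (r - s)) ∈ convexHull ℝ U} := by
      intro q hq q' hq' a b ha hb hab
      have := convex_convexHull ℝ U hq hq' ha hb hab
      simp only [mem_ofPred_eq]
      convert this using 1
      refine Prod.ext (by simp) ?_
      simp only [Prod.snd_add, Prod.smul_snd, smul_eq_mul]
      linear_combination (r - s) * hab
    refine fun q hq => convexHull_min (fun q hq => ?_) hconv hq
    exact subset_convexHull ℝ U (hU q.1 q.2 _ hq (by linarith))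
  have hcont : Continuous fun q : E × ℝ => (q.1, q.2 - (r - s)) := by fun_prop
  have := map_mem_closure hcont h hmap
  simpa using this

/-- Every family of functions has a concave cap. -/
lemma isConcaveCap_hypographSup {d : ℕ} {ι : Type*} (s : Set ι) (f : ι → (Fin d → ℝ) → EReal) :
    IsConcaveCap (hypographSup (closure (convexHull ℝ (⋃ B ∈ s, hypograph (f B))))) s f := by
  refine hypograph_hypographSup isClosed_closure (down_mem_closure_convexHull ?_)
  intro x r r' h hr
  simp only [mem_iUnion] at h ⊢
  obtain ⟨B, hB, hmem⟩ := h
  exact ⟨B, hB, (EReal.coe_le_coe hr).trans hmem⟩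

end ConcaveCap

/-! ### Well-posedness of the recursion and the price formula. -/

namespace Market

variable {Ω : Type*} [MeasurableSpace Ω] {d T : ℕ}

open Classical in
/-- The restriction of `f` to the price vectors that are consistent at the node `A`. -/
noncomputable def truncate (M : Market Ω d T) (i : Fin d) (t : ℕ) (A : Set Ω)
    (f : (Fin d → ℝ) → EReal) (S : Fin d → ℝ) : EReal :=
  if ∀ ω ∈ A, IsConsistentPrice (M.bidAsk t ω) i S then f S else ⊥

/-- The value functions `n` time steps before maturity. -/
noncomputable def valueToGo (M : Market Ω d T) (X : Ω → Fin d → ℝ) (i : Fin d) :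
    ℕ → Set Ω → (Fin d → ℝ) → EReal
  -- The infimum is over a constant, `X` being constant on a node; it avoids choosing a point of
  -- `A`.
  | 0 => fun A => M.truncate i T A fun S => ⨅ ω ∈ A, ((X ω ⬝ᵥ S : ℝ) : EReal)
  | n + 1 => fun A => hypographSup (closure (convexHull ℝ
      (⋃ B ∈ M.succNodes (T - (n + 1)) A,
        hypograph (M.truncate i (T - n) B (M.valueToGo X i n B)))))

lemma truncate_of_consistent {M : Market Ω d T} {i : Fin d} {t : ℕ} (ht : t ≤ T) {A : Set Ω}
    (hA : A ∈ M.nodes t) {ω : Ω} (hω : ω ∈ A) {f : (Fin d → ℝ) → EReal} {S : Fin d → ℝ}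
    (hS : IsConsistentPrice (M.bidAsk t ω) i S) : M.truncate i t A f S = f S :=
  if_pos fun _ hω' => bidAsk_eq ht hA hω hω' ▸ hS

lemma truncate_of_not_consistent {M : Market Ω d T} {i : Fin d} {t : ℕ} {A : Set Ω} {ω : Ω}
    (hω : ω ∈ A) {f : (Fin d → ℝ) → EReal} {S : Fin d → ℝ}
    (hS : ¬ IsConsistentPrice (M.bidAsk t ω) i S) : M.truncate i t A f S = ⊥ :=
  if_neg fun h => hS (h ω hω)

/-- The backward algorithm is well defined. -/
lemma exists_isScalarAlgorithm (M : Market Ω d T) {X : Ω → Fin d → ℝ} (hX : Measurable X)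
    (i : Fin d) : ∃ V W : ℕ → Set Ω → (Fin d → ℝ) → EReal, M.IsScalarAlgorithm X i V W := by
  refine ⟨fun t A => M.valueToGo X i (T - t) A,
    fun t A => M.truncate i t A (M.valueToGo X i (T - t) A), ?_, ?_, ?_, ?_, ?_, ?_⟩
  · intro A hA ω hω S hS
    simp only [Nat.sub_self, valueToGo]
    rw [truncate_of_consistent le_rfl hA hω hS]
    refine le_antisymm (iInf₂_le ω hω) (le_iInf₂ fun ω' hω' => ?_)
    rw [eq_of_mem_sigmaAtoms (M.measurable_last hX) hA hω hω']
  · intro A hA ω hω S hS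
    simp only [Nat.sub_self, valueToGo]
    exact truncate_of_not_consistent hω hS
  · intro A hA
    obtain ⟨ω, hω⟩ := hA.2.1
    funext S
    by_cases hS : IsConsistentPrice (M.bidAsk T ω) i S
    · exact truncate_of_consistent le_rfl hA hω hS
    · simp only [Nat.sub_self, valueToGo]
      rw [truncate_of_not_consistent hω hS, truncate_of_not_consistent hω hS]
  · intro t ht A hA
    obtain ⟨n, rfl⟩ : ∃ n, T = t + (n + 1) := ⟨T - t - 1, by omega⟩
    have h1 : t + (n + 1) - t = n + 1 := by omega
    have h2 : t + (n + 1) - (n + 1) = t := by omega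
    have h3 : t + (n + 1) - n = t + 1 := by omega
    have h4 : t + (n + 1) - (t + 1) = n := by omega
    simp only [h1, valueToGo, h2, h3, h4]
    exact isConcaveCap_hypographSup _ _
  · intro t ht A hA ω hω S hS
    exact truncate_of_consistent ht.le hA hω hS
  · intro t ht A hA ω hω S hS
    exact truncate_of_not_consistent hω hS

namespace IsScalarAlgorithm

variable {M : Market Ω d T} {P : Measure Ω} {X : Ω → Fin d → ℝ} {i : Fin d}
  {V W : ℕ → Set Ω → (Fin d → ℝ) → EReal}

/-- If the initial function were `⊥` everywhere, any endowment would superhedge `X`, even `-(c •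
e)`. For large `c`, `X ω + c • e` can be traded into `e` in every state, an arbitrage. -/
lemma exists_truncated_ne_bot [Finite Ω] [Nonempty Ω] (h : M.IsScalarAlgorithm X i V W)
    (hP : ∀ ω : Ω, 0 < P {ω}) (hNA : M.NoArbitrage P) (hX : Measurable X) :
    ∃ S, W 0 univ S ≠ ⊥ := by
  by_contra! hbot
  let e : Fin d → ℝ := Pi.single i 1
  obtain ⟨c, hc⟩ := (finite_range fun ω => ∑ j, |(X ω - e) j| * M.bidAsk T ω i j).bddAbove
  have hatt : (fun ω => X ω - (-(c • e))) ∈ M.attainable P :=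
    (sub_mem_attainable_iff hP hX _).2 (h.exists_strategy hX fun S => hbot S ▸ EReal.bot_lt_coe _)
  have he : (fun _ : Ω => e) ∈ M.attainable P := by
    refine attainable_of_sub_mem_cone hP hatt measurable_const fun ω => ?_
    have := add_smul_single_mem_solvencyCone (M.isBidAsk T le_rfl ω) i (X ω - e) (hc ⟨ω, rfl⟩)
    have heq : X ω - -(c • e) - e = X ω - e + c • e := by module
    rw [heq]
    exact this
  have hzero := forall_of_ae_of_forall_singleton_pos hP
    (hNA _ he (Filter.Eventually.of_forall fun _ => Pi.single_nonneg.2 zero_le_one))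
    (Classical.arbitrary Ω)
  simpa [e] using congrFun hzero i

lemma exists_scalarPrice_eq_isGreatest [Finite Ω] [Nonempty Ω] (h : M.IsScalarAlgorithm X i V W)
    (hP : ∀ ω : Ω, 0 < P {ω}) (hNA : M.NoArbitrage P) (hX : Measurable X) :
    ∃ r : ℝ, M.scalarPrice P X i = (r : EReal) ∧ IsGreatest (range (W 0 univ)) (r : EReal) := by
  have hnode := M.univ_mem_nodes_zero
  let ω₀ : Ω := Classical.arbitrary Ω
  have hp := M.isBidAsk 0 (Nat.zero_le T) ω₀
  have hK := isCompact_setOf_isConsistentPrice hp i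
  obtain ⟨c, hc⟩ := h.exists_bound
  obtain ⟨-, hclosed, -, hle⟩ := hc 0 (Nat.zero_le T) univ hnode
  have hdom : ∀ S, W 0 univ S ≠ ⊥ → IsConsistentPrice (M.bidAsk 0 ω₀) i S := fun S hS => by
    by_contra hcon
    exact hS (h.truncated_eq_bot (Nat.zero_le T) hnode (mem_univ ω₀) hcon)
  obtain ⟨S₀, hS₀⟩ := h.exists_truncated_ne_bot hP hNA hX
  have hclosed' : IsClosed (hypograph (W 0 univ)) := by
    rw [h.hypograph_truncated (Nat.zero_le T) hnode (mem_univ ω₀)]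
    exact hclosed.inter (hK.isClosed.prod isClosed_univ)
  obtain ⟨r, hr⟩ := exists_isGreatest_range hK hclosed' hdom
    (fun S => (h.truncated_le (Nat.zero_le T) hnode S).trans (hle S)) hS₀
  refine ⟨r, le_antisymm ?_ ?_, hr⟩
  -- Each `s > r` is strictly above the initial function, so it starts a superhedging strategy.
  · refine EReal.le_of_forall_lt_iff_le.1 fun s hs => ?_
    have hmem : s • (Pi.single i 1 : Fin d → ℝ) ∈ M.superhedgingPortfolios P X := by
      refine (sub_mem_attainable_iff hP hX _).2 (h.exists_strategy hX fun S => ?_)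
      by_cases hS : W 0 univ S = ⊥
      · rw [hS]
        exact EReal.bot_lt_coe _
      · have : (s • (Pi.single i 1 : Fin d → ℝ)) ⬝ᵥ S = s := by
          simp [(hdom S hS).1]
        rw [this]
        exact (hr.2 ⟨S, rfl⟩).trans_lt hs
    refine (iInf₂_le _ ⟨hmem, s, rfl⟩).trans ?_
    simp
  · refine le_iInf₂ fun u hu => ?_
    obtain ⟨hu, s, rfl⟩ := hu
    obtain ⟨Y, hY, h0, hstep, hT⟩ := (sub_mem_attainable_iff hP hX _).1 hu
    -- At a maximiser `S`, `r ≤ Y 0 ω₀ ⬝ᵥ S ≤ s`.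
    obtain ⟨S, hS⟩ := hr.1
    have hcon := hdom S (by rw [hS]; exact EReal.coe_ne_bot r)
    have h1 := h.le_dotProduct hY hstep hT (Nat.zero_le T) hnode (mem_univ ω₀) S
    rw [← h.truncated_eq (Nat.zero_le T) hnode (mem_univ ω₀) hcon, hS,
      EReal.coe_le_coe_iff] at h1
    have h2 := hcon.dotProduct_nonneg hp (h0 ω₀)
    rw [sub_dotProduct, smul_dotProduct, single_dotProduct, hcon.1] at h2
    refine EReal.coe_le_coe ?_
    simp only [smul_eq_mul, mul_one, Pi.smul_apply, Pi.single_eq_same] at h2 ⊢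
    linarith

end IsScalarAlgorithm

end Market

theorem mainTheorem6 {Ω : Type*} [Finite Ω] [MeasurableSpace Ω] (P : Measure Ω)
    [IsProbabilityMeasure P] (hP : ∀ ω : Ω, 0 < P {ω}) {d T : ℕ} (M : Market Ω d T)
    (hNA : M.NoArbitrage P) (X : Ω → Fin d → ℝ) (hX : Measurable X) (i : Fin d) :
    (∃ V W : ℕ → Set Ω → (Fin d → ℝ) → EReal, M.IsScalarAlgorithm X i V W) ∧
    ∀ V W : ℕ → Set Ω → (Fin d → ℝ) → EReal, M.IsScalarAlgorithm X i V W →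
      (∀ t ≤ T, ∀ A ∈ M.nodes t,
        (∀ S, V t A S ≠ ⊤ ∧ W t A S ≠ ⊤) ∧
        Convex ℝ (hypograph (V t A)) ∧ Convex ℝ (hypograph (W t A))) ∧
      ∃ p : ℝ, M.scalarPrice P X i = (p : EReal) ∧
        IsGreatest (Set.range (W 0 Set.univ)) (p : EReal) := by
  have : Nonempty Ω := nonempty_of_isProbabilityMeasure P
  refine ⟨M.exists_isScalarAlgorithm hX i, fun V W h =>
    ⟨fun t ht A hA => ?_, h.exists_scalarPrice_eq_isGreatest hP hNA hX⟩⟩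
  obtain ⟨c, hc⟩ := h.exists_bound
  obtain ⟨hconv, -, -, hle⟩ := hc t ht A hA
  refine ⟨fun S => ⟨ne_top_of_forall_le_coe hle S, ne_top_of_forall_le_coe
    (fun S => (h.truncated_le ht hA S).trans (hle S)) S⟩, hconv, ?_⟩
  obtain ⟨ω, hω⟩ := hA.2.1
  rw [h.hypograph_truncated ht hA hω]
  exact hconv.inter ((convex_setOf_isConsistentPrice _ i).prod convex_univ)
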